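/- Let $\mathcal H$ be a complex Hilbert space (inner product linear in its first argument). A linear relation in $\mathcal H$ is a linear subspace $T\subset\mathcal H^2=\mathcal H\oplus\mathcal H$; operators are identified with their graphs, $[\mathcal H]$ denotes the bounded everywhere defined operators, and $T^*=\{\{h,k\}: (k,f)=(h,g)\ \text{for all } \{f,g\}\in T\}$. The relation $T$ is dissipative (accumulative) if $\operatorname{Im}(f',f)\ge 0$ ($\le 0$) for all $\{f,f'\}\in T$, and maximal dissipative (accumulative) if it has no proper dissipative (accumulative) extension among linear relations. A family $M(\lambda)$, $\lambda\in\mathbb C\setminus\mathbb R$, of linear relations in $\mathcal H$ is a Nevanlinna family if (a) $M(\lambda)$ is maximal dissipative for $\lambda\in\mathbb C_+$ and maximal accumulative for $\lambda\in\mathbb C_-$; (b) $M(\lambda)^*=M(\bar\lambda)$ for all $\lambda\in\mathbb C\setminus\mathbb R$; (c) for some $\mu\in\mathbb C_+$ (respectively, some $\mu\in\mathbb C_-$) one has $(M(\lambda)+\mu)^{-1}\in[\mathcal H]$ for all $\lambda\in\mathbb C_+$ (respectively $\mathbb C_-$), and this operator function is holomorphic there. Let $\widetilde R(\mathcal H)$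 be the class of all Nevanlinna families, and let - $\widetilde R^c(\mathcal H)$ be the class of $M\in\widetilde R(\mathcal H)$ that are constant on $\mathbb C\setminus\mathbb R$; - $R^s(\mathcal H)$ (strict) be the class of $M\in\widetilde R(\mathcal H)$ with $M(\lambda)\cap M(\lambda)^*=\{0\}$ for all $\lambda\in\mathbb C\setminus\mathbb R$; - $R^u(\mathcal H)$ (uniformly strict) be the class of $M\in\widetilde R(\mathcal H)$ whose componentwise sum satisfies $M(\lambda)\,\widehat+\,M(\lambda)^*=\mathcal H^2$ for all $\lambda\in\mathbb C\setminus\mathbb R$; - $R^u[\mathcal H]$ be the class of $M\in\widetilde R(\mathcal H)$ with $\operatorname{dom}M(\lambda)=\mathcal H$, $\ker\operatorname{Im}M(\lambda)=\{0\}$ and $0\in\rho(\operatorname{Im}M(\lambda))$ for all $\lambda\in\mathbb C\setminus\mathbb R$, where $\operatorname{Im}T=\frac1{2i}(T-T^*)$. Let $J_{\mathcal H}=\begin{pmatrix}0&-iI\\ iI&0\end{pmatrix}$ on $\mathcal H^2$, and let $W$ be a standard unitary operator in the Krein space $(\mathcal H^2,J_{\mathcal H})$, that is, a linear relation in $\mathcal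 H^2$ with $W^{-1}=W^{[*]}:=J_{\mathcal H}W^*J_{\mathcal H}$ and $W\in[\mathcal H^2]$. The Shmul'yan transform of a linear relation $\Theta$ in $\mathcal H$ induced by $W$ is the linear relation $W[\Theta]=\{\widehat k\in\mathcal H^2:\{\widehat h,\widehat k\}\in W\text{ for some }\widehat h\in\Theta\}$, and a family $M$ is transformed pointwise into $\lambda\mapsto W[M(\lambda)]$. **Theorem.** Each of the following classes is mapped into itself by the Shmul'yan transform induced by $W$: 1. the class $\widetilde R(\mathcal H)$ of all Nevanlinna families; 2. the class $\widetilde R^c(\mathcal H)$ of constant Nevanlinna families; 3. the class $R^s(\mathcal H)$ of strict Nevanlinna functions; 4. the class $R^u(\mathcal H)$ of uniformly strict Nevanlinna functions, and moreover $R^u(\mathcal H)=R^u[\mathcal H]$. -/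

import Mathlib

open scoped ComplexConjugate

namespace Nevanlinna

noncomputable section

/-- A linear relation from `E` to `F`: a linear subspace of `E × F`. The Hilbert space adjoint `T*`
of a relation `T` is Mathlib's `Submodule.adjoint`. -/
abbrev LinRel (E F : Type*) [AddCommGroup E] [Module ℂ E] [AddCommGroup F] [Module ℂ F] :=
  Submodule ℂ (E × F)

section Relations

variable {E F : Type*} [NormedAddCommGroup E] [InnerProductSpace ℂ E]
  [NormedAddCommGroup F] [InnerProductSpace ℂ F]

/-- The domain of a linear relation. -/
def dom (T : LinRel E F) : Submodule ℂ E := T.map (LinearMap.fst ℂ E F)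

/-- The inverse relation `{(f', f) : (f, f') ∈ T}`. -/
def inv (T : LinRel E F) : LinRel F E := T.comap (LinearEquiv.prodComm ℂ F E).toLinearMap

/-- The graph of a bounded everywhere defined operator. -/
def graph (A : E →L[ℂ] F) : LinRel E F := LinearMap.graph (A : E →ₗ[ℂ] F)

/-- `T ∈ [E, F]`: the relation `T` is (the graph of) a bounded everywhere defined operator. -/
def IsBoundedOp (T : LinRel E F) : Prop := ∃ A : E →L[ℂ] F, T = graph A

/-- The kernel of a linear relation. -/
def ker (T : LinRel E F) : Submodule ℂ E := T.comap (LinearMap.inl ℂ E F)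

end Relations

section Krein

/-- The Hilbert space `H² = H ⊕ H`, with the Hilbert (`ℓ²`) sum inner product. -/
abbrev Sq (H : Type*) : Type _ := WithLp 2 (H × H)

variable {E F : Type*} [NormedAddCommGroup E] [InnerProductSpace ℂ E]
  [NormedAddCommGroup F] [InnerProductSpace ℂ F]

/-- The adjoint `T^[*] = jE T* jF` (a product of relations) of a relation `T` from the Krein space
`(E, jE)` to the Krein space `(F, jF)`, that is,
`{(α, β) : ∃ γ, (jF α, γ) ∈ T* and β = jE γ}`. -/
def kreinAdjoint (jE : E →L[ℂ] E) (jF : F →L[ℂ] F) (T : LinRel E F) : LinRel F E :=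
  (T.adjoint.comap ((jF : F →ₗ[ℂ] F).prodMap (LinearMap.id : E →ₗ[ℂ] E))).map
    ((LinearMap.id : F →ₗ[ℂ] F).prodMap (jE : E →ₗ[ℂ] E))

/-- A relation `T` between Krein spaces is unitary when `T⁻¹ = T^[*]`. -/
def IsKreinUnitary (jE : E →L[ℂ] E) (jF : F →L[ℂ] F) (T : LinRel E F) : Prop :=
  inv T = kreinAdjoint jE jF T

/-- A standard unitary operator between Krein spaces: a unitary relation which is a bounded
everywhere defined operator. -/
def IsStandardUnitary (jE : E →L[ℂ] E) (jF : F →L[ℂ] F) (T : LinRel E F) : Prop :=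
  IsKreinUnitary jE jF T ∧ IsBoundedOp T

variable (H : Type*) [NormedAddCommGroup H] [InnerProductSpace ℂ H]

/-- The fundamental symmetry `J (f, f') = (-i f', i f)` of `H²`. -/
def J : Sq H →L[ℂ] Sq H :=
  (WithLp.prodContinuousLinearEquiv 2 ℂ H H).symm.toContinuousLinearMap ∘L
    ((-Complex.I • ContinuousLinearMap.snd ℂ H H).prod
      (Complex.I • ContinuousLinearMap.fst ℂ H H)) ∘L
    (WithLp.prodContinuousLinearEquiv 2 ℂ H H).toContinuousLinearMap

end Krein

section Families

variable {H K : Type*} [NormedAddCommGroup H] [InnerProductSpace ℂ H]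
  [NormedAddCommGroup K] [InnerProductSpace ℂ K]

/-- The Shmul'yan transform `W[Θ] = {k : ∃ h ∈ Θ, (h, k) ∈ W}` of a relation `Θ` in `H` induced by
a relation `W` from `H²` to `K²`. -/
def shmulyan (W : LinRel (Sq H) (Sq K)) (Θ : LinRel H H) : LinRel K K where
  carrier := {k | ∃ h ∈ Θ, (WithLp.toLp 2 h, WithLp.toLp 2 k) ∈ W}
  add_mem' := by
    rintro a b ⟨h, hh, hW⟩ ⟨h', hh', hW'⟩
    exact ⟨h + h', Θ.add_mem hh hh', by simpa using W.add_mem hW hW'⟩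
  zero_mem' := ⟨0, Θ.zero_mem, W.zero_mem⟩
  smul_mem' := by
    rintro c a ⟨h, hh, hW⟩
    exact ⟨c • h, Θ.smul_mem c hh, by simpa using W.smul_mem c hW⟩

/-- The relation `T + μ = {(f, f' + μ f) : (f, f') ∈ T}`. -/
def shift (T : LinRel H H) (μ : ℂ) : LinRel H H :=
  T.map ((LinearMap.fst ℂ H H).prod (LinearMap.snd ℂ H H + μ • LinearMap.fst ℂ H H))

/-- The imaginary part `Im T = (T - T*) / 2i` of a relation, as a linear relation:
`{(f, (g - h) / 2i) : (f, g) ∈ T, (f, h) ∈ T*}`. -/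
def imPart (T : LinRel H H) : LinRel H H where
  carrier := {p | ∃ g h, (p.1, g) ∈ T ∧ (p.1, h) ∈ T.adjoint ∧
    p.2 = (2 * Complex.I)⁻¹ • (g - h)}
  add_mem' := by
    rintro a b ⟨g, h, hg, hh, e⟩ ⟨g', h', hg', hh', e'⟩
    exact ⟨g + g', h + h', T.add_mem hg hg', T.adjoint.add_mem hh hh', by
      rw [Prod.snd_add, e, e', ← smul_add]; congr 1; abel⟩
  zero_mem' := ⟨0, 0, T.zero_mem, T.adjoint.zero_mem, by simp⟩
  smul_mem' := by
    rintro c a ⟨g, h, hg, hh, e⟩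
    exact ⟨c • g, c • h, T.smul_mem c hg, T.adjoint.smul_mem c hh, by
      rw [Prod.smul_snd, e, ← smul_sub, smul_comm]⟩

/-- `Im (f', f) ≥ 0` for all `(f, f') ∈ T`. Mathlib's inner product is linear in its second
argument, so `(f', f)` is `inner ℂ f f'`. -/
def IsDissipative (T : LinRel H H) : Prop := ∀ p ∈ T, 0 ≤ (inner ℂ p.1 p.2 : ℂ).im

/-- `Im (f', f) ≤ 0` for all `(f, f') ∈ T`. -/
def IsAccumulative (T : LinRel H H) : Prop := ∀ p ∈ T, (inner ℂ p.1 p.2 : ℂ).im ≤ 0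

/-- A dissipative relation without proper dissipative extensions. -/
def IsMaxDissipative (T : LinRel H H) : Prop :=
  IsDissipative T ∧ ∀ T' : LinRel H H, IsDissipative T' → T ≤ T' → T' = T

/-- An accumulative relation without proper accumulative extensions. -/
def IsMaxAccumulative (T : LinRel H H) : Prop :=
  IsAccumulative T ∧ ∀ T' : LinRel H H, IsAccumulative T' → T ≤ T' → T' = T

/-- The relations `(M(z) + μ)⁻¹`, `z ∈ U`, are bounded everywhere defined operators, and they
depend holomorphically on `z ∈ U`, in operator norm. -/
def HolomorphicInvShift (M : ℂ → LinRel H H) (μ : ℂ) (U : Set ℂ) : Prop :=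
  ∃ R : ℂ → H →L[ℂ] H, DifferentiableOn ℂ R U ∧ ∀ z ∈ U, inv (shift (M z) μ) = graph (R z)

/-- Nevanlinna families in `H`. A family is indexed by the nonreal numbers: the values of the
function `M` on the real line play no role, here and in the classes below. -/
structure IsNevanlinnaFamily (M : ℂ → LinRel H H) : Prop where
  maxDissipative : ∀ z : ℂ, 0 < z.im → IsMaxDissipative (M z)
  maxAccumulative : ∀ z : ℂ, z.im < 0 → IsMaxAccumulative (M z)
  adjoint_eq : ∀ z : ℂ, z.im ≠ 0 → (M z).adjoint = M (conj z)
  holomorphic_upper : ∃ μ : ℂ, 0 < μ.im ∧ HolomorphicInvShift M μ {z | 0 < z.im}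
  holomorphic_lower : ∃ μ : ℂ, μ.im < 0 ∧ HolomorphicInvShift M μ {z | z.im < 0}

variable (H)

/-- The class `R̃(H)` of all Nevanlinna families. -/
def Rtilde : Set (ℂ → LinRel H H) := {M | IsNevanlinnaFamily M}

/-- The class `R̃ᶜ(H)` of constant Nevanlinna families. -/
def Rconst : Set (ℂ → LinRel H H) :=
  {M | M ∈ Rtilde H ∧ ∃ Θ : LinRel H H, ∀ z : ℂ, z.im ≠ 0 → M z = Θ}

/-- The class `Rˢ(H)`: Nevanlinna families with `M(z) ∩ M(z)* = {0}` for all nonreal `z`. -/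
def Rstrict : Set (ℂ → LinRel H H) :=
  {M | M ∈ Rtilde H ∧ ∀ z : ℂ, z.im ≠ 0 → M z ⊓ (M z).adjoint = ⊥}

/-- The class `Rᵘ(H)`: Nevanlinna families with componentwise sum `M(z) + M(z)* = H²` for all
nonreal `z`. -/
def Runif : Set (ℂ → LinRel H H) :=
  {M | M ∈ Rtilde H ∧ ∀ z : ℂ, z.im ≠ 0 → M z ⊔ (M z).adjoint = ⊤}

/-- The class `R[H]`: Nevanlinna families with `dom M(z) = H` for all nonreal `z`. -/
def Rbdd : Set (ℂ → LinRel H H) :=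
  {M | M ∈ Rtilde H ∧ ∀ z : ℂ, z.im ≠ 0 → dom (M z) = ⊤}

/-- The class `Rˢ[H]`: functions in `R[H]` with `ker Im M(z) = {0}` for all nonreal `z`. -/
def RstrictBdd : Set (ℂ → LinRel H H) :=
  {M | M ∈ Rbdd H ∧ ∀ z : ℂ, z.im ≠ 0 → ker (imPart (M z)) = ⊥}

/-- The class `Rᵘ[H]`: functions in `Rˢ[H]` with `0 ∈ ρ(Im M(z))`, i.e. `(Im M(z))⁻¹ ∈ [H]`, for
all nonreal `z`. -/
def RunifBdd : Set (ℂ → LinRel H H) :=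
  {M | M ∈ RstrictBdd H ∧ ∀ z : ℂ, z.im ≠ 0 → IsBoundedOp (inv (imPart (M z)))}

end Families

end

end Nevanlinna

/-! A standard unitary `W` acts on `H × H` as a topological isomorphism `e` preserving the form
`sympForm`, and `shmulyan W` is the image under `e`. Semidefiniteness is the sign of the imaginary
part of the form on the diagonal, and the adjoint is the orthogonal companion. Both, together with
maximality, intersections and sums, are therefore carried along by `e`.

Only holomorphy of `(M(z) + μ)⁻¹` is not visibly invariant. With `R` this resolvent, `M(z)` is
parametrized by `h ↦ (R h, h - μ R h)`. Applying `e` gives a holomorphic parametrization `(X h, Y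
h)` of the transform. Its resolvent is `X (Y + μ X)⁻¹`, where the inverse exists because `T + μ` is
bounded below and onto for every maximal semidefinite `T` of the matching sign.

For `Runif H = RunifBdd H`, the open mapping theorem turns `T ⊔ T* = ⊤` into decompositions with
norm bounds. A Cauchy–Schwarz argument then makes the form uniformly definite on `T`, so `‖x.2‖` is
controlled by `‖x.1‖`. The same holds for `T*`, and so the domain is everything. Invertibility of
`Im T` amounts to decomposing the vectors `(0, 2i v)` along `T` and `T*`. -/

namespace Nevanlinna

/-! ### The symplectic form and its relation to adjoints and `J`. -/

section SymplecticForm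

variable {H : Type*} [NormedAddCommGroup H] [InnerProductSpace ℂ H]

/-- The symplectic form `(x, y) ↦ ⟪x₁, y₂⟫ - ⟪x₂, y₁⟫` on `H × H`; it is `i` times the indefinite
inner product of the Krein space `(H², J)`. -/
noncomputable def sympForm (x y : H × H) : ℂ := inner ℂ x.1 y.2 - inner ℂ x.2 y.1

theorem mem_adjoint_iff_sympForm {T : LinRel H H} {x : H × H} :
    x ∈ T.adjoint ↔ ∀ y ∈ T, sympForm y x = 0 := by
  rw [Submodule.mem_adjoint_iff]
  constructor
  · rintro h ⟨a, b⟩ hy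
    have := h a b hy
    simp only [sympForm]
    rw [← neg_eq_zero, neg_sub, this]
  · intro h a b hy
    have := h (a, b) hy
    simp only [sympForm] at this
    rw [← neg_eq_zero, neg_sub, this]

theorem conj_sympForm (x y : H × H) : conj (sympForm x y) = -sympForm y x := by
  simp [sympForm, inner_conj_symm]

theorem sympForm_self_im (x : H × H) : (sympForm x x).im = 2 * (inner ℂ x.1 x.2 : ℂ).im := by
  have : (inner ℂ x.2 x.1 : ℂ).im = -(inner ℂ x.1 x.2 : ℂ).im := by
    rw [← inner_conj_symm, Complex.conj_im]
  simp only [sympForm, Complex.sub_im, this]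
  ring

theorem sympForm_add_left (x y z : H × H) : sympForm (x + y) z = sympForm x z + sympForm y z := by
  simp only [sympForm, Prod.fst_add, Prod.snd_add, inner_add_left]
  ring

theorem sympForm_add_right (x y z : H × H) : sympForm x (y + z) = sympForm x y + sympForm x z := by
  simp only [sympForm, Prod.fst_add, Prod.snd_add, inner_add_right]
  ring

theorem sympForm_smul_left (c : ℂ) (x y : H × H) : sympForm (c • x) y = conj c * sympForm x y := by
  simp only [sympForm, Prod.smul_fst, Prod.smul_snd, inner_smul_left]
  ring

theorem sympForm_smul_right (c : ℂ) (x y : H × H) : sympForm x (c • y) = c * sympForm x y := by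
  simp only [sympForm, Prod.smul_fst, Prod.smul_snd, inner_smul_right]
  ring

theorem inner_smul_self_im (c : ℂ) (x : H) : (inner ℂ x (c • x) : ℂ).im = c.im * ‖x‖ ^ 2 := by
  have h : (inner ℂ x x : ℂ) = ((‖x‖ ^ 2 : ℝ) : ℂ) := by
    rw [inner_self_eq_norm_sq_to_K]
    norm_cast
  rw [inner_smul_right, h, Complex.im_mul_ofReal]

theorem J_apply_fst (x : Sq H) : (J H x).fst = -Complex.I • x.snd := rfl

theorem J_apply_snd (x : Sq H) : (J H x).snd = Complex.I • x.fst := rfl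

theorem J_J_apply (x : Sq H) : J H (J H x) = x := by
  apply (WithLp.equiv 2 (H × H)).injective
  refine Prod.ext ?_ ?_
  · change (J H (J H x)).fst = x.fst
    rw [J_apply_fst, J_apply_snd, smul_smul]
    simp
  · change (J H (J H x)).snd = x.snd
    rw [J_apply_snd, J_apply_fst, smul_smul]
    simp

theorem inner_J_apply (x y : Sq H) :
    inner ℂ x (J H y) = -Complex.I * sympForm x.ofLp y.ofLp := by
  rw [WithLp.prod_inner_apply]
  change inner ℂ x.fst (J H y).fst + inner ℂ x.snd (J H y).snd = _
  rw [J_apply_fst, J_apply_snd, inner_smul_right, inner_smul_right]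
  simp only [sympForm]
  change _ = -Complex.I * (inner ℂ x.fst y.snd - inner ℂ x.snd y.fst)
  ring

/-- The adjoint is the companion for `sympForm`, so it commutes with any bijection that preserves
the form. -/
theorem adjoint_map_of_sympForm {e : (H × H) ≃L[ℂ] (H × H)}
    (he : ∀ x y, sympForm (e x) (e y) = sympForm x y) (T : LinRel H H) :
    (T.map ((e : (H × H) →L[ℂ] (H × H)) : (H × H) →ₗ[ℂ] (H × H))).adjoint =
      T.adjoint.map ((e : (H × H) →L[ℂ] (H × H)) : (H × H) →ₗ[ℂ] (H × H)) := by
  ext x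
  constructor
  · intro hx
    refine ⟨e.symm x, mem_adjoint_iff_sympForm.2 fun y hy => ?_, e.apply_symm_apply x⟩
    rw [← he, e.apply_symm_apply]
    exact mem_adjoint_iff_sympForm.1 hx _ ⟨y, hy, rfl⟩
  · rintro ⟨x, hx, rfl⟩
    refine mem_adjoint_iff_sympForm.2 ?_
    rintro _ ⟨y, hy, rfl⟩
    exact (he y x).trans (mem_adjoint_iff_sympForm.1 hx y hy)

end SymplecticForm

/-! ### Standard unitary operators as symplectic isomorphisms. -/

section StandardUnitary

variable {H : Type*} [NormedAddCommGroup H] [InnerProductSpace ℂ H] [CompleteSpace H]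

/-- A standard unitary operator in `(H², J)` acts on `H × H` as a topological isomorphism that
preserves the symplectic form. -/
theorem IsStandardUnitary.exists_continuousLinearEquiv {W : LinRel (Sq H) (Sq H)}
    (hW : IsStandardUnitary (J H) (J H) W) :
    ∃ e : (H × H) ≃L[ℂ] (H × H), (∀ x y, sympForm (e x) (e y) = sympForm x y) ∧
      ∀ Θ : LinRel H H, shmulyan W Θ = Θ.map ((e : (H × H) →L[ℂ] (H × H)) : (H × H) →ₗ[ℂ] (H × H)) := by
  obtain ⟨hU, A, rfl⟩ := hW
  have mem_graph : ∀ x y, (x, y) ∈ graph A ↔ y = A x := fun x y => Iff.rfl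
  have mem_adj : ∀ x y, (x, y) ∈ kreinAdjoint (J H) (J H) (graph A) ↔
      ∀ u, inner ℂ (A u) (J H x) = inner ℂ u (J H y) := by
    intro x y
    have h₁ : (x, y) ∈ kreinAdjoint (J H) (J H) (graph A) ↔ (J H x, J H y) ∈ (graph A).adjoint := by
      constructor
      · rintro ⟨⟨a, c⟩, hac, he⟩
        obtain ⟨rfl, rfl⟩ := Prod.mk.inj he
        simpa [J_J_apply] using hac
      · intro h
        exact ⟨(x, J H y), h, Prod.ext rfl (J_J_apply y)⟩
    rw [h₁, Submodule.mem_adjoint_iff]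
    constructor
    · intro h u
      exact sub_eq_zero.1 (h u (A u) rfl)
    · intro h a b hb
      obtain rfl : b = A a := hb
      exact sub_eq_zero.2 (h a)
  -- The equality `W⁻¹ = W^[*]` read pointwise. The forward direction is isometry, which with
  -- nondegeneracy gives injectivity; the backward one gives surjectivity.
  have mem_inv : ∀ x y, x = A y ↔ ∀ u, inner ℂ (A u) (J H x) = inner ℂ u (J H y) := by
    intro x y
    rw [← mem_adj, ← hU]
    rfl
  have hiso : ∀ x y, inner ℂ (A x) (J H (A y)) = inner ℂ x (J H y) := fun x y =>
    (mem_inv (A y) y).1 rfl x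
  let P := WithLp.prodContinuousLinearEquiv 2 ℂ H H
  let B : (H × H) →L[ℂ] (H × H) := P.toContinuousLinearMap ∘L A ∘L P.symm.toContinuousLinearMap
  have hinj : Function.Injective A := by
    refine (injective_iff_map_eq_zero A).2 fun y hy => ?_
    have h := fun x => hiso x y
    simp only [hy, map_zero, inner_zero_right] at h
    have h₂ : J H y = 0 := inner_self_eq_zero.1 (h (J H y)).symm
    rw [← J_J_apply y, h₂, map_zero]
  have hsurj : Function.Surjective A := by
    intro x
    -- The Krein adjoint `J A* J` is a right inverse of `A`.
    refine ⟨J H (A.adjoint (J H x)), ((mem_inv _ _).2 fun u => ?_).symm⟩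
    rw [J_J_apply, ContinuousLinearMap.adjoint_inner_right]
  have hBi : Function.Injective B := P.injective.comp (hinj.comp P.symm.injective)
  have hBs : Function.Surjective B := P.surjective.comp (hsurj.comp P.symm.surjective)
  refine ⟨ContinuousLinearEquiv.ofBijective B (LinearMap.ker_eq_bot.2 hBi)
    (LinearMap.range_eq_top.2 hBs), fun x y => ?_, fun Θ => ?_⟩
  · have h := hiso (WithLp.toLp 2 x) (WithLp.toLp 2 y)
    rw [inner_J_apply, inner_J_apply] at h
    exact mul_left_cancel₀ (neg_ne_zero.2 Complex.I_ne_zero) h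
  · ext k
    constructor
    · rintro ⟨h, hh, hk⟩
      exact ⟨h, hh, congrArg WithLp.ofLp ((mem_graph _ _).1 hk).symm⟩
    · rintro ⟨h, hh, rfl⟩
      exact ⟨h, hh, rfl⟩

end StandardUnitary

/-! ### Semidefinite relations, with a sign `σ` treating both half-planes at once. -/

section Semidefinite

variable {H : Type*} [NormedAddCommGroup H] [InnerProductSpace ℂ H]

/-- `σ Im (f', f) ≥ 0` for all `(f, f') ∈ T`: dissipative relations for `σ = 1`, accumulative ones
for `σ = -1`. -/
def IsSemi (σ : ℝ) (T : LinRel H H) : Prop := ∀ p ∈ T, 0 ≤ σ * (inner ℂ p.1 p.2 : ℂ).im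

/-- Relations with `σ Im (f', f) ≥ 0` that have no proper extension of the same kind. -/
def IsMaxSemi (σ : ℝ) (T : LinRel H H) : Prop :=
  IsSemi σ T ∧ ∀ T' : LinRel H H, IsSemi σ T' → T ≤ T' → T' = T

theorem isMaxSemi_one_iff {T : LinRel H H} : IsMaxSemi 1 T ↔ IsMaxDissipative T := by
  simp only [IsMaxSemi, IsSemi, IsMaxDissipative, IsDissipative, one_mul]

theorem isMaxSemi_neg_one_iff {T : LinRel H H} : IsMaxSemi (-1) T ↔ IsMaxAccumulative T := by
  simp only [IsMaxSemi, IsSemi, IsMaxAccumulative, IsAccumulative, neg_one_mul, neg_nonneg]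

theorem isSemi_iff_sympForm {σ : ℝ} {T : LinRel H H} :
    IsSemi σ T ↔ ∀ p ∈ T, 0 ≤ σ * (sympForm p p).im := by
  refine forall₂_congr fun p _ => ?_
  rw [sympForm_self_im]
  constructor <;> intro h <;> linarith

/-- The sign condition is closed, so the closure is a semidefinite extension and maximality applies.
-/
theorem IsMaxSemi.isClosed {σ : ℝ} {T : LinRel H H} (hT : IsMaxSemi σ T) :
    IsClosed (T : Set (H × H)) := by
  have h : T.topologicalClosure = T := by
    refine hT.2 _ (fun p hp => ?_) T.le_topologicalClosure
    have hc : IsClosed {p : H × H | 0 ≤ σ * (inner ℂ p.1 p.2 : ℂ).im} :=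
      isClosed_le continuous_const
        (continuous_const.mul (Complex.continuous_im.comp (continuous_fst.inner continuous_snd)))
    exact closure_minimal (fun q hq => hT.1 q hq) hc hp
  rw [← h]
  exact T.isClosed_topologicalClosure

theorem IsMaxSemi.map [CompleteSpace H] {σ : ℝ} {T : LinRel H H} (hT : IsMaxSemi σ T)
    {e : (H × H) ≃L[ℂ] (H × H)} (he : ∀ x y, sympForm (e x) (e y) = sympForm x y) :
    IsMaxSemi σ (T.map ((e : (H × H) →L[ℂ] (H × H)) : (H × H) →ₗ[ℂ] (H × H))) := by
  refine ⟨isSemi_iff_sympForm.2 ?_, fun T' hT' hle => ?_⟩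
  · rintro _ ⟨p, hp, rfl⟩
    have := isSemi_iff_sympForm.1 hT.1 p hp
    rwa [← he] at this
  · have h := hT.2 (T'.comap ((e : (H × H) →L[ℂ] (H × H)) : (H × H) →ₗ[ℂ] (H × H)))
      (isSemi_iff_sympForm.2 fun p hp => by
        rw [← he]
        exact isSemi_iff_sympForm.1 hT' _ hp) (Submodule.map_le_iff_le_comap.1 hle)
    rw [← h]
    exact (Submodule.map_comap_eq_of_surjective e.surjective T').symm

/-- A relation with `σ Im (f', f) ≥ 0` is bounded below by `T + μ` if `σ Im μ > 0`. -/
theorem IsSemi.exists_norm_le {σ : ℝ} {T : LinRel H H} (hT : IsSemi σ T) {μ : ℂ}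
    (hμ : 0 < σ * μ.im) : ∃ K : NNReal, ∀ p ∈ T, ‖p‖ ≤ K * ‖p.2 + μ • p.1‖ := by
  -- From `σ Im μ ‖p.1‖² ≤ σ Im ⟪p.1, p.2 + μ p.1⟫ ≤ |σ| ‖p.1‖ ‖p.2 + μ p.1‖`.
  set c : ℝ := |σ| / (σ * μ.im) with hc
  have hc0 : 0 ≤ c := by positivity
  have h₁ : ∀ p ∈ T, ‖p.1‖ ≤ c * ‖p.2 + μ • p.1‖ := by
    intro p hp
    have h₂ := hT p hp
    have h₃ : (inner ℂ p.1 (p.2 + μ • p.1) : ℂ).im = (inner ℂ p.1 p.2 : ℂ).im + μ.im * ‖p.1‖ ^ 2 := by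
      rw [inner_add_right, Complex.add_im, inner_smul_self_im]
    have h₄ : σ * (inner ℂ p.1 (p.2 + μ • p.1) : ℂ).im ≤ |σ| * (‖p.1‖ * ‖p.2 + μ • p.1‖) := by
      refine (le_abs_self _).trans ?_
      rw [abs_mul]
      gcongr
      exact (Complex.abs_im_le_norm _).trans (norm_inner_le_norm _ _)
    have h₅ : ‖p.1‖ * (σ * μ.im * ‖p.1‖) ≤ ‖p.1‖ * (|σ| * ‖p.2 + μ • p.1‖) := by
      rw [h₃] at h₄
      nlinarith
    rw [hc, div_mul_eq_mul_div, le_div_iff₀ hμ]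
    rcases (norm_nonneg p.1).eq_or_lt with h | h
    · rw [← h, zero_mul]
      positivity
    · linarith [le_of_mul_le_mul_left h₅ h]
  refine ⟨⟨c + (1 + ‖μ‖ * c), by positivity⟩, fun p hp => ?_⟩
  have h₂ := h₁ p hp
  have h₃ : ‖p.2‖ ≤ ‖p.2 + μ • p.1‖ + ‖μ‖ * ‖p.1‖ := by
    rw [← norm_smul]
    exact norm_le_add_norm_add _ _
  have h₄ : ‖μ‖ * ‖p.1‖ ≤ ‖μ‖ * (c * ‖p.2 + μ • p.1‖) := by gcongr
  have h₅ : 0 ≤ c * ‖p.2 + μ • p.1‖ := by positivity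
  have h₆ : 0 ≤ ‖μ‖ * (c * ‖p.2 + μ • p.1‖) := by positivity
  have h₇ := norm_nonneg (p.2 + μ • p.1)
  change max ‖p.1‖ ‖p.2‖ ≤ (c + (1 + ‖μ‖ * c)) * ‖p.2 + μ • p.1‖
  refine max_le ?_ ?_ <;> linarith

/-- A closed subspace on which a continuous linear map is bounded below has closed image. -/
theorem isClosed_map_of_norm_le {E F : Type*} [NormedAddCommGroup E] [NormedSpace ℂ E]
    [CompleteSpace E] [NormedAddCommGroup F] [NormedSpace ℂ F] (f : E →L[ℂ] F) {T : Submodule ℂ E}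
    (hT : IsClosed (T : Set E)) {K : NNReal} (hK : ∀ x ∈ T, ‖x‖ ≤ K * ‖f x‖) :
    IsClosed (T.map (f : E →ₗ[ℂ] F) : Set F) := by
  have : CompleteSpace T := hT.completeSpace_coe
  let g : T →L[ℂ] F := f ∘L T.subtypeL
  have hg : AntilipschitzWith K g := g.antilipschitz_of_bound fun x => hK x x.2
  have h := hg.isClosed_range g.uniformContinuous
  convert h using 1
  ext y
  simp [g]

theorem eq_top_of_isClosed_of_orthogonal [CompleteSpace H] {S : Submodule ℂ H}
    (hS : IsClosed (S : Set H)) (h : ∀ y, (∀ x ∈ S, inner ℂ x y = 0) → y = 0) : S = ⊤ := by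
  have : CompleteSpace S := hS.completeSpace_coe
  rw [← Submodule.orthogonal_eq_bot_iff]
  exact (Submodule.eq_bot_iff _).2 fun y hy => h y fun x hx => (Submodule.mem_orthogonal _ _).1 hy x hx

/-- If `T` is maximal with `σ Im (f', f) ≥ 0` and `σ Im μ > 0`, then `T + μ` is onto. -/
theorem IsMaxSemi.exists_snd_add_smul_fst_eq [CompleteSpace H] {σ : ℝ} {T : LinRel H H}
    (hT : IsMaxSemi σ T) {μ : ℂ} (hμ : 0 < σ * μ.im) (h : H) : ∃ p ∈ T, p.2 + μ • p.1 = h := by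
  obtain ⟨K, hK⟩ := hT.1.exists_norm_le hμ
  let f : (H × H) →L[ℂ] H := ContinuousLinearMap.snd ℂ H H + μ • ContinuousLinearMap.fst ℂ H H
  suffices hS : T.map (f : (H × H) →ₗ[ℂ] H) = ⊤ by
    have : h ∈ T.map (f : (H × H) →ₗ[ℂ] H) := hS ▸ Submodule.mem_top
    obtain ⟨p, hp, rfl⟩ := this
    exact ⟨p, hp, rfl⟩
  refine eq_top_of_isClosed_of_orthogonal (isClosed_map_of_norm_le f hT.isClosed hK) fun y hy => ?_
  have hy' : ∀ p ∈ T, (inner ℂ p.2 y : ℂ) = -(conj μ * inner ℂ p.1 y) := by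
    intro p hp
    have h₁ : inner ℂ (p.2 + μ • p.1) y = 0 := hy _ ⟨p, hp, rfl⟩
    rw [inner_add_left, inner_smul_left] at h₁
    exact eq_neg_of_add_eq_zero_left h₁
  -- Orthogonality of `y` to the range of `T + μ` says `q ∈ T*`. Since `q` also has the sign of `σ`,
  -- adjoining it keeps `T` semidefinite. Maximality gives `q ∈ T`, so `q` is neutral and `y = 0`.
  set q : H × H := (y, -conj μ • y) with hq
  have hpq : ∀ p ∈ T, sympForm p q = 0 := by
    intro p hp
    simp only [sympForm, hq, inner_smul_right, hy' p hp]
    ring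
  have hqq : (sympForm q q).im = 2 * (μ.im * ‖y‖ ^ 2) := by
    rw [sympForm_self_im, hq, inner_smul_self_im, Complex.neg_im, Complex.conj_im, neg_neg]
  have hsemi : IsSemi σ (T ⊔ Submodule.span ℂ {q}) := by
    refine isSemi_iff_sympForm.2 fun x hx => ?_
    obtain ⟨p, hp, r, hr, rfl⟩ := Submodule.mem_sup.1 hx
    obtain ⟨c, rfl⟩ := Submodule.mem_span_singleton.1 hr
    have h₁ : sympForm q p = 0 := by
      rw [← neg_eq_zero, ← conj_sympForm, hpq p hp, map_zero]
    have h₂ : sympForm (p + c • q) (p + c • q) = sympForm p p + (Complex.normSq c : ℂ) * sympForm q q := by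
      rw [Complex.normSq_eq_conj_mul_self]
      simp only [sympForm_add_left, sympForm_add_right, sympForm_smul_left, sympForm_smul_right,
        hpq p hp, h₁]
      ring
    rw [h₂, Complex.add_im, Complex.im_ofReal_mul, hqq]
    have h₃ := isSemi_iff_sympForm.1 hT.1 p hp
    have h₄ : 0 ≤ Complex.normSq c * ‖y‖ ^ 2 * (σ * μ.im) :=
      mul_nonneg (mul_nonneg (Complex.normSq_nonneg c) (sq_nonneg _)) hμ.le
    nlinarith
  have hqT : q ∈ T := by
    rw [← hT.2 _ hsemi le_sup_left]
    exact Submodule.mem_sup_right (Submodule.mem_span_singleton_self q)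
  have h₅ := hpq q hqT
  rw [h₅, Complex.zero_im] at hqq
  have hμ0 : μ.im ≠ 0 := fun h => by simp [h] at hμ
  have : ‖y‖ ^ 2 = 0 := by
    rcases mul_eq_zero.1 ((mul_eq_zero.1 hqq.symm).resolve_left two_ne_zero) with h | h
    · exact absurd h hμ0
    · exact h
  simpa using this

end Semidefinite

/-! ### Holomorphy of the transformed resolvent. -/

section Holomorphic

variable {H : Type*} [NormedAddCommGroup H] [InnerProductSpace ℂ H]

theorem mem_inv_shift_iff {T : LinRel H H} {μ : ℂ} {a b : H} :
    (a, b) ∈ inv (shift T μ) ↔ (b, a - μ • b) ∈ T := by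
  change (b, a) ∈ shift T μ ↔ _
  constructor
  · rintro ⟨p, hp, he⟩
    obtain ⟨h₁, h₂⟩ := Prod.mk.inj he
    simp only [LinearMap.fst_apply] at h₁
    have h₂ : p.2 + μ • p.1 = a := h₂
    rw [← h₂, ← h₁, add_sub_cancel_right]
    exact hp
  · intro h
    exact ⟨_, h, Prod.ext rfl (sub_add_cancel a (μ • b))⟩

theorem HolomorphicInvShift.map [CompleteSpace H] {M : ℂ → LinRel H H} {μ : ℂ} {U : Set ℂ} {σ : ℝ}
    (hM : HolomorphicInvShift M μ U) (hμ : 0 < σ * μ.im) (hU : ∀ z ∈ U, IsMaxSemi σ (M z))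
    {e : (H × H) ≃L[ℂ] (H × H)} (he : ∀ x y, sympForm (e x) (e y) = sympForm x y) :
    HolomorphicInvShift
      (fun z => (M z).map ((e : (H × H) →L[ℂ] (H × H)) : (H × H) →ₗ[ℂ] (H × H))) μ U := by
  obtain ⟨R, hR, hMR⟩ := hM
  have mem_M : ∀ z ∈ U, ∀ p, p ∈ M z ↔ p.1 = R z (p.2 + μ • p.1) := by
    intro z hz p
    have h : (p.2 + μ • p.1, p.1) ∈ inv (shift (M z) μ) ↔ p ∈ M z := by
      rw [mem_inv_shift_iff, add_sub_cancel_right]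
    rw [← h, hMR z hz]
    rfl
  have mem_M' : ∀ z ∈ U, ∀ h, (R z h, h - μ • R z h) ∈ M z := by
    intro z hz h
    rw [mem_M z hz]
    simp
  let E : (H × H) →L[ℂ] (H × H) := e
  let fstL := ContinuousLinearMap.fst ℂ H H
  let sndL := ContinuousLinearMap.snd ℂ H H
  let inlL := ContinuousLinearMap.inl ℂ H H
  let inrL := ContinuousLinearMap.inr ℂ H H
  let X : ℂ → H →L[ℂ] H := fun z =>
    (fstL ∘L E ∘L inlL) * R z + (fstL ∘L E ∘L inrL) * (1 - μ • R z)
  let Y : ℂ → H →L[ℂ] H := fun z =>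
    (sndL ∘L E ∘L inlL) * R z + (sndL ∘L E ∘L inrL) * (1 - μ • R z)
  have hXY : ∀ z h, (X z h, Y z h) = e (R z h, h - μ • R z h) := by
    intro z h
    have h₁ : (R z h, h - μ • R z h) = (R z h, (0 : H)) + ((0 : H), h - μ • R z h) := by simp
    rw [h₁, map_add]
    rfl
  have hXd : DifferentiableOn ℂ X U :=
    (hR.const_mul _).add (((differentiableOn_const _).sub (hR.const_smul μ)).const_mul _)
  have hYd : DifferentiableOn ℂ Y U :=
    (hR.const_mul _).add (((differentiableOn_const _).sub (hR.const_smul μ)).const_mul _)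
  let D : ℂ → H →L[ℂ] H := fun z => Y z + μ • X z
  have hDd : DifferentiableOn ℂ D U := hYd.add (hXd.const_smul μ)
  have mem_map : ∀ z ∈ U, ∀ h, (X z h, Y z h) ∈
      (M z).map ((e : (H × H) →L[ℂ] (H × H)) : (H × H) →ₗ[ℂ] (H × H)) := fun z hz h =>
    ⟨_, mem_M' z hz h, (hXY z h).symm⟩
  have exists_of_mem_map : ∀ z ∈ U, ∀ q ∈
      (M z).map ((e : (H × H) →L[ℂ] (H × H)) : (H × H) →ₗ[ℂ] (H × H)), ∃ h, q = (X z h, Y z h) := by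
    rintro z hz _ ⟨p, hp, rfl⟩
    refine ⟨p.2 + μ • p.1, ?_⟩
    rw [hXY, ← (mem_M z hz p).1 hp, add_sub_cancel_right]
    rfl
  -- `D z` is `T + μ` in the parametrization of the image relation `T`: the lower bound gives
  -- injectivity, maximality surjectivity.
  have hunit : ∀ z ∈ U, IsUnit (D z) := by
    intro z hz
    have hmax := (hU z hz).map he
    refine ContinuousLinearMap.isUnit_iff_bijective.2
      ⟨(injective_iff_map_eq_zero (D z)).2 fun h hh => ?_, fun h => ?_⟩
    · obtain ⟨K, hK⟩ := hmax.1.exists_norm_le hμ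
      have h₁ := hK _ (mem_map z hz h)
      have h₂ : Y z h + μ • X z h = 0 := hh
      rw [h₂, norm_zero, mul_zero, norm_le_zero_iff, hXY, map_eq_zero_iff e e.injective] at h₁
      obtain ⟨h₃, h₄⟩ := Prod.mk.inj h₁
      simpa [h₃] using h₄
    · obtain ⟨q, hq, rfl⟩ := hmax.exists_snd_add_smul_fst_eq hμ h
      obtain ⟨k, rfl⟩ := exists_of_mem_map z hz q hq
      exact ⟨k, rfl⟩
  refine ⟨fun z => X z * Ring.inverse (D z), hXd.mul (hDd.inverse hunit), fun z hz => ?_⟩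
  have hl : ∀ h, Ring.inverse (D z) (D z h) = h := fun h =>
    congrArg (fun A : H →L[ℂ] H => A h) (Ring.inverse_mul_cancel _ (hunit z hz))
  have hr : ∀ h, D z (Ring.inverse (D z) h) = h := fun h =>
    congrArg (fun A : H →L[ℂ] H => A h) (Ring.mul_inverse_cancel _ (hunit z hz))
  ext ⟨a, b⟩
  rw [mem_inv_shift_iff]
  change _ ↔ b = X z (Ring.inverse (D z) a)
  constructor
  · intro h
    obtain ⟨k, hk⟩ := exists_of_mem_map z hz _ h
    obtain ⟨rfl, h₂⟩ := Prod.mk.inj hk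
    have h₃ : a = D z k := sub_eq_iff_eq_add.1 h₂
    rw [h₃, hl]
  · rintro rfl
    convert mem_map z hz (Ring.inverse (D z) a) using 2
    exact sub_eq_iff_eq_add.2 (hr a).symm

end Holomorphic

/-! ### Nevanlinna families under symplectic isomorphisms. -/

section Families

variable {H : Type*} [NormedAddCommGroup H] [InnerProductSpace ℂ H]

theorem IsNevanlinnaFamily.map [CompleteSpace H] {M : ℂ → LinRel H H} (hM : IsNevanlinnaFamily M)
    {e : (H × H) ≃L[ℂ] (H × H)} (he : ∀ x y, sympForm (e x) (e y) = sympForm x y) :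
    IsNevanlinnaFamily
      (fun z => (M z).map ((e : (H × H) →L[ℂ] (H × H)) : (H × H) →ₗ[ℂ] (H × H))) where
  maxDissipative z hz :=
    isMaxSemi_one_iff.1 ((isMaxSemi_one_iff.2 (hM.maxDissipative z hz)).map he)
  maxAccumulative z hz :=
    isMaxSemi_neg_one_iff.1 ((isMaxSemi_neg_one_iff.2 (hM.maxAccumulative z hz)).map he)
  adjoint_eq z hz := by rw [adjoint_map_of_sympForm he, hM.adjoint_eq z hz]
  holomorphic_upper := by
    obtain ⟨μ, hμ, h⟩ := hM.holomorphic_upper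
    exact ⟨μ, hμ, h.map (σ := 1) (by simpa using hμ)
      (fun z hz => isMaxSemi_one_iff.2 (hM.maxDissipative z hz)) he⟩
  holomorphic_lower := by
    obtain ⟨μ, hμ, h⟩ := hM.holomorphic_lower
    exact ⟨μ, hμ, h.map (σ := -1) (by simpa using hμ)
      (fun z hz => isMaxSemi_neg_one_iff.2 (hM.maxAccumulative z hz)) he⟩

theorem IsNevanlinnaFamily.exists_isMaxSemi {M : ℂ → LinRel H H} (hM : IsNevanlinnaFamily M) {z : ℂ}
    (hz : z.im ≠ 0) : ∃ σ : ℝ, |σ| = 1 ∧ IsMaxSemi σ (M z) := by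
  rcases hz.lt_or_gt with h | h
  · exact ⟨-1, by simp, isMaxSemi_neg_one_iff.2 (hM.maxAccumulative z h)⟩
  · exact ⟨1, by simp, isMaxSemi_one_iff.2 (hM.maxDissipative z h)⟩

theorem IsNevanlinnaFamily.adjoint_adjoint {M : ℂ → LinRel H H} (hM : IsNevanlinnaFamily M) {z : ℂ}
    (hz : z.im ≠ 0) : (M z).adjoint.adjoint = M z := by
  rw [hM.adjoint_eq z hz, hM.adjoint_eq (conj z) (by simpa using hz), Complex.conj_conj]

/-! ### Uniformly strict families and the imaginary part. -/

/-- If two closed subspaces of a Banach space span it, the components can be chosen with control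
of their norms. -/
theorem exists_add_eq_norm_le {E : Type*} [NormedAddCommGroup E] [NormedSpace ℂ E] [CompleteSpace E]
    {S T : Submodule ℂ E} (hS : IsClosed (S : Set E)) (hT : IsClosed (T : Set E)) (h : S ⊔ T = ⊤) :
    ∃ C > 0, ∀ y, ∃ a ∈ S, ∃ b ∈ T, a + b = y ∧ ‖a‖ ≤ C * ‖y‖ := by
  have : CompleteSpace S := hS.completeSpace_coe
  have : CompleteSpace T := hT.completeSpace_coe
  obtain ⟨C, hC, hy⟩ := (S.subtypeL.coprod T.subtypeL).exists_preimage_norm_le (fun y => by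
    obtain ⟨a, ha, b, hb, rfl⟩ := Submodule.mem_sup.1 (h ▸ Submodule.mem_top : y ∈ S ⊔ T)
    exact ⟨(⟨a, ha⟩, ⟨b, hb⟩), rfl⟩)
  refine ⟨C, hC, fun y => ?_⟩
  obtain ⟨x, hx, hn⟩ := hy y
  exact ⟨x.1, x.1.2, x.2, x.2.2, hx, (norm_fst_le x).trans hn⟩

/-- A semidefinite relation `T` with `T ⊞ T* = H²` is uniformly definite. -/
theorem IsSemi.exists_sq_norm_le [CompleteSpace H] {σ : ℝ} (hσ : |σ| = 1) {T : LinRel H H}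
    (hT : IsSemi σ T) (hc : IsClosed (T : Set (H × H)))
    (hc' : IsClosed (T.adjoint : Set (H × H))) (hsup : T ⊔ T.adjoint = ⊤) :
    ∃ K : NNReal, ∀ x ∈ T, ‖x.1‖ ^ 2 + ‖x.2‖ ^ 2 ≤ K * (σ * (inner ℂ x.1 x.2 : ℂ).im) := by
  obtain ⟨C, hC, hdec⟩ := exists_add_eq_norm_le hc hc' hsup
  refine ⟨⟨4 * C ^ 2, by positivity⟩, fun x hx => ?_⟩
  -- This vector pairs with `x` to `‖x.1‖² + ‖x.2‖²`. The component `b ∈ T*` contributes nothing, so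
  -- `a ∈ T` carries the whole value.
  obtain ⟨a, ha, b, hb, hab, hn⟩ := hdec (x.2, -x.1)
  set N : ℝ := ‖x.1‖ ^ 2 + ‖x.2‖ ^ 2 with hN
  have hax : sympForm a x = N := by
    have h₁ : sympForm b x = 0 := by
      rw [← neg_eq_zero, ← conj_sympForm, mem_adjoint_iff_sympForm.1 hb x hx, map_zero]
    have h₂ : sympForm (a + b) x = N := by
      rw [hab]
      simp only [sympForm, inner_neg_left, inner_self_eq_norm_sq_to_K, hN]
      push_cast
      simp only [Complex.coe_algebraMap]
      ring
    rwa [sympForm_add_left, h₁, add_zero] at h₂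
  have hxa : sympForm x a = -N := by
    rw [← neg_neg (sympForm x a), ← conj_sympForm, hax, Complex.conj_ofReal]
  have hσ2 : σ * σ = 1 := by rw [← abs_mul_abs_self, hσ, one_mul]
  have haa : σ * (inner ℂ a.1 a.2 : ℂ).im ≤ C ^ 2 * N := by
    have h₁ : σ * (inner ℂ a.1 a.2 : ℂ).im ≤ ‖a.1‖ * ‖a.2‖ := by
      refine (le_abs_self _).trans ?_
      rw [abs_mul, hσ, one_mul]
      exact (Complex.abs_im_le_norm _).trans (norm_inner_le_norm _ _)
    have h₂ : ‖((x.2, -x.1) : H × H)‖ ^ 2 ≤ N := by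
      rw [Prod.norm_mk, norm_neg]
      rcases max_cases ‖x.2‖ ‖x.1‖ with h | h <;> rw [h.1, hN] <;>
        nlinarith [sq_nonneg ‖x.1‖, sq_nonneg ‖x.2‖]
    calc σ * (inner ℂ a.1 a.2 : ℂ).im ≤ ‖a.1‖ * ‖a.2‖ := h₁
      _ ≤ ‖a‖ * ‖a‖ := by
        gcongr
        exacts [norm_fst_le a, norm_snd_le a]
      _ ≤ (C * ‖((x.2, -x.1) : H × H)‖) * (C * ‖((x.2, -x.1) : H × H)‖) := by gcongr
      _ = C ^ 2 * ‖((x.2, -x.1) : H × H)‖ ^ 2 := by ring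
      _ ≤ C ^ 2 * N := by gcongr
  -- Cauchy–Schwarz in quadratic form: semidefiniteness at `x + iσε a`, where the phase makes the
  -- cross term `-2εN`.
  have key : ∀ ε : ℝ, 2 * (ε * N) ≤
      2 * (σ * (inner ℂ x.1 x.2 : ℂ).im) + ε ^ 2 * (2 * (σ * (inner ℂ a.1 a.2 : ℂ).im)) := by
    intro ε
    have h₁ := isSemi_iff_sympForm.1 hT (x + (Complex.I * (σ * ε : ℝ)) • a)
      (T.add_mem hx (T.smul_mem _ ha))
    have h₂ : sympForm (x + (Complex.I * (σ * ε : ℝ)) • a) (x + (Complex.I * (σ * ε : ℝ)) • a) =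
        sympForm x x + ((σ * ε) ^ 2 : ℝ) * sympForm a a - (2 * (σ * ε) * N : ℝ) * Complex.I := by
      simp only [sympForm_add_left, sympForm_add_right, sympForm_smul_left, sympForm_smul_right,
        hax, hxa, map_mul, Complex.conj_I, Complex.conj_ofReal]
      push_cast
      linear_combination (-(σ * ε : ℂ) ^ 2 * sympForm a a) * Complex.I_sq
    rw [h₂, Complex.sub_im, Complex.add_im, Complex.im_ofReal_mul, Complex.im_ofReal_mul,
      Complex.I_im, sympForm_self_im, sympForm_self_im] at h₁
    have h₃ : σ * (2 * (inner ℂ x.1 x.2 : ℂ).im + (σ * ε) ^ 2 * (2 * (inner ℂ a.1 a.2 : ℂ).im)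
          - 2 * (σ * ε) * N * 1) = 2 * (σ * (inner ℂ x.1 x.2 : ℂ).im)
          + (σ * σ) * ε ^ 2 * (2 * (σ * (inner ℂ a.1 a.2 : ℂ).im)) - 2 * ((σ * σ) * ε * N) := by ring
    rw [h₃, hσ2, one_mul, one_mul] at h₁
    linarith
  -- This `ε` maximizes `εN - ε²C²N`, with value `N / (4C²)`.
  have h₁ := key (1 / (2 * C ^ 2))
  have h₂ : (1 / (2 * C ^ 2)) ^ 2 * (2 * (σ * (inner ℂ a.1 a.2 : ℂ).im)) ≤
      (1 / (2 * C ^ 2)) ^ 2 * (2 * (C ^ 2 * N)) := by gcongr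
  have h₃ : (1 / (2 * C ^ 2)) ^ 2 * (2 * (C ^ 2 * N)) = 2 * (N / (4 * C ^ 2)) := by
    field_simp
    ring
  have h₄ : 2 * (1 / (2 * C ^ 2) * N) = 4 * (N / (4 * C ^ 2)) := by
    field_simp
  have h₅ : N / (4 * C ^ 2) ≤ σ * (inner ℂ x.1 x.2 : ℂ).im := by linarith
  rw [div_le_iff₀ (by positivity)] at h₅
  change N ≤ 4 * C ^ 2 * _
  linarith

/-- Uniform definiteness gives `‖x.2‖² ≤ K ‖x.1‖ ‖x.2‖`, and one factor cancels. -/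
theorem IsSemi.exists_norm_snd_le [CompleteSpace H] {σ : ℝ} (hσ : |σ| = 1) {T : LinRel H H}
    (hT : IsSemi σ T) (hc : IsClosed (T : Set (H × H)))
    (hc' : IsClosed (T.adjoint : Set (H × H))) (hsup : T ⊔ T.adjoint = ⊤) :
    ∃ K : NNReal, ∀ x ∈ T, ‖x.2‖ ≤ K * ‖x.1‖ := by
  obtain ⟨K, hK⟩ := hT.exists_sq_norm_le hσ hc hc' hsup
  refine ⟨K, fun x hx => ?_⟩
  have h₁ : σ * (inner ℂ x.1 x.2 : ℂ).im ≤ ‖x.1‖ * ‖x.2‖ := by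
    refine (le_abs_self _).trans ?_
    rw [abs_mul, hσ, one_mul]
    exact (Complex.abs_im_le_norm _).trans (norm_inner_le_norm _ _)
  have h₂ : (K : ℝ) * (σ * (inner ℂ x.1 x.2 : ℂ).im) ≤ K * (‖x.1‖ * ‖x.2‖) := by gcongr
  have h₃ : ‖x.2‖ * ‖x.2‖ ≤ ‖x.2‖ * (K * ‖x.1‖) := by nlinarith [hK x hx, sq_nonneg ‖x.1‖]
  rcases (norm_nonneg x.2).eq_or_lt with h | h
  · rw [← h]
    positivity
  · exact le_of_mul_le_mul_left h₃ h

/-- If a relation has no multivalued part in a uniform sense, and neither has its adjoint, then its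
domain is the whole space. -/
theorem dom_eq_top_of_norm_snd_le [CompleteSpace H] {T : LinRel H H}
    (hc : IsClosed (T : Set (H × H))) {K K' : NNReal} (hK : ∀ x ∈ T, ‖x.2‖ ≤ K * ‖x.1‖)
    (hK' : ∀ x ∈ T.adjoint, ‖x.2‖ ≤ K' * ‖x.1‖) : dom T = ⊤ := by
  refine eq_top_of_isClosed_of_orthogonal
    (isClosed_map_of_norm_le (ContinuousLinearMap.fst ℂ H H) hc (K := 1 + K) fun x hx => ?_)
    fun y hy => ?_
  · have := hK x hx
    have h₁ : 0 ≤ (K : ℝ) * ‖x.1‖ := by positivity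
    have h₂ := norm_nonneg x.1
    change max ‖x.1‖ ‖x.2‖ ≤ ((1 + K : NNReal) : ℝ) * ‖x.1‖
    push_cast
    refine max_le ?_ ?_ <;> linarith
  -- A vector orthogonal to the domain lies in the multivalued part of `T*`, which the bound on `T*`
  -- makes trivial.
  · have h : ((0 : H), y) ∈ T.adjoint := mem_adjoint_iff_sympForm.2 fun p hp => by
      simpa [sympForm] using hy p.1 ⟨p, hp, rfl⟩
    simpa using hK' _ h

/-- A relation that contains a pair over each point, with norm control, and whose only pair over `0`
is `0`, is a bounded everywhere defined operator. -/
theorem isBoundedOp_of_norm_le {S : LinRel H H} {C : ℝ}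
    (hS : ∀ v, ∃ a, (v, a) ∈ S ∧ ‖a‖ ≤ C * ‖v‖) (h0 : ∀ a, (0, a) ∈ S → a = 0) :
    IsBoundedOp S := by
  choose f hf hn using hS
  have huniq : ∀ v a, (v, a) ∈ S → a = f v := fun v a h => by
    refine sub_eq_zero.1 (h0 _ ?_)
    simpa using S.sub_mem h (hf v)
  let A : H →ₗ[ℂ] H :=
    { toFun := f
      map_add' := fun x y => (huniq _ _ (S.add_mem (hf x) (hf y))).symm
      map_smul' := fun c x => (huniq _ _ (S.smul_mem c (hf x))).symm }
  refine ⟨A.mkContinuous C hn, ?_⟩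
  ext ⟨v, a⟩
  exact ⟨huniq v a, fun h => (show a = f v from h) ▸ hf v⟩

/-- A common vector pairs to zero with both `T` and `T*`, hence with all of `H × H`, and the form is
nondegenerate. -/
theorem inf_adjoint_eq_bot_of_sup_eq_top {T : LinRel H H} (hT : T.adjoint.adjoint = T)
    (hsup : T ⊔ T.adjoint = ⊤) : T ⊓ T.adjoint = ⊥ := by
  refine (Submodule.eq_bot_iff _).2 fun x hx => ?_
  obtain ⟨h₁, h₂⟩ := Submodule.mem_inf.1 hx
  have h : ∀ y, sympForm y x = 0 := fun y => by
    obtain ⟨a, ha, b, hb, rfl⟩ :=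
      Submodule.mem_sup.1 (hsup ▸ Submodule.mem_top : y ∈ T ⊔ T.adjoint)
    rw [sympForm_add_left, mem_adjoint_iff_sympForm.1 h₂ a ha,
      mem_adjoint_iff_sympForm.1 (hT.symm ▸ h₁ : x ∈ T.adjoint.adjoint) b hb, add_zero]
  have e₁ := h (x.2, 0)
  have e₂ := h (0, x.1)
  simp only [sympForm, inner_zero_left, sub_zero, zero_sub, neg_eq_zero, inner_self_eq_zero] at e₁ e₂
  exact Prod.ext e₂ e₁

theorem ker_imPart_eq_bot {T : LinRel H H} (h : T ⊓ T.adjoint = ⊥) : ker (imPart T) = ⊥ := by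
  refine (Submodule.eq_bot_iff _).2 ?_
  rintro a ⟨g, k, hg, hk, he⟩
  have h₁ : g = k := by simpa [sub_eq_zero] using he.symm
  subst h₁
  have h₂ : (a, g) ∈ T ⊓ T.adjoint := ⟨hg, hk⟩
  rw [h] at h₂
  exact (Prod.mk.inj ((Submodule.mem_bot ℂ).1 h₂)).1

theorem isBoundedOp_inv_imPart [CompleteSpace H] {T : LinRel H H}
    (hc : IsClosed (T : Set (H × H))) (hc' : IsClosed (T.adjoint : Set (H × H)))
    (hsup : T ⊔ T.adjoint = ⊤) (hinf : T ⊓ T.adjoint = ⊥) : IsBoundedOp (inv (imPart T)) := by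
  obtain ⟨C, hC, hdec⟩ := exists_add_eq_norm_le hc hc' hsup
  have hI : (2 * Complex.I) ≠ 0 := mul_ne_zero two_ne_zero Complex.I_ne_zero
  refine isBoundedOp_of_norm_le (C := C * 2) (fun v => ?_) fun a ha => ?_
  -- Here `b.1 = -a.1`, so `-b` lies in `T*` over `a.1` and `(a.1, v) ∈ Im T`.
  · obtain ⟨a, ha, b, hb, hab, hn⟩ := hdec (0, (2 * Complex.I) • v)
    obtain ⟨h₁, h₂⟩ := Prod.ext_iff.1 hab
    simp only [Prod.fst_add, Prod.snd_add] at h₁ h₂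
    refine ⟨a.1, ⟨a.2, -b.2, ha, ?_, ?_⟩, ?_⟩
    · have := T.adjoint.neg_mem hb
      convert this using 1
      exact Prod.ext (eq_neg_of_add_eq_zero_left h₁) rfl
    · change v = _
      rw [sub_neg_eq_add, h₂, inv_smul_smul₀ hI]
    · refine (norm_fst_le a).trans (hn.trans (le_of_eq ?_))
      simp [norm_smul, mul_assoc]
  · have h : a ∈ ker (imPart T) := ha
    rwa [ker_imPart_eq_bot hinf] at h

theorem sup_adjoint_eq_top {T : LinRel H H} (hdom : dom T.adjoint = ⊤)
    (hb : IsBoundedOp (inv (imPart T))) : T ⊔ T.adjoint = ⊤ := by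
  obtain ⟨A, hA⟩ := hb
  have hI : (2 * Complex.I) ≠ 0 := mul_ne_zero two_ne_zero Complex.I_ne_zero
  refine eq_top_iff.2 fun x _ => ?_
  -- Subtracting `p ∈ T*` over `x.1` leaves a vertical vector `(0, 2i v)`, which inverting `Im T`
  -- writes as a difference of elements of `T` and `T*` over `A v`.
  obtain ⟨p, hp, hpx⟩ := (hdom ▸ Submodule.mem_top : x.1 ∈ dom T.adjoint)
  have hpx : p.1 = x.1 := hpx
  set v := (2 * Complex.I)⁻¹ • (x.2 - p.2) with hv
  have hmem : (v, A v) ∈ inv (imPart T) := hA ▸ (rfl : A v = A v)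
  obtain ⟨g, k, hg, hk, he⟩ := hmem
  have he : v = (2 * Complex.I)⁻¹ • (g - k) := he
  have h₁ : x.2 - p.2 = g - k := smul_right_injective H (inv_ne_zero hI) (hv.symm.trans he)
  refine Submodule.mem_sup.2 ⟨_, hg, p - (A v, k), T.adjoint.sub_mem hp hk, Prod.ext ?_ ?_⟩
  · change A v + (p.1 - A v) = x.1
    rw [hpx]
    abel
  · change g + (p.2 - k) = x.2
    rw [sub_eq_iff_eq_add.1 h₁]
    abel

theorem runif_eq_runifBdd [CompleteSpace H] : Runif H = RunifBdd H := by
  ext M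
  constructor
  · rintro ⟨hM, hsup⟩
    have hM' : IsNevanlinnaFamily M := hM
    have hclosed : ∀ z : ℂ, z.im ≠ 0 → IsClosed (M z : Set (H × H)) := fun z hz => by
      obtain ⟨σ, -, h⟩ := hM'.exists_isMaxSemi hz
      exact h.isClosed
    have hclosed' : ∀ z : ℂ, z.im ≠ 0 → IsClosed ((M z).adjoint : Set (H × H)) := fun z hz => by
      rw [hM'.adjoint_eq z hz]
      exact hclosed _ (by simpa using hz)
    have hinf : ∀ z : ℂ, z.im ≠ 0 → M z ⊓ (M z).adjoint = ⊥ := fun z hz =>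
      inf_adjoint_eq_bot_of_sup_eq_top (hM'.adjoint_adjoint hz) (hsup z hz)
    have hbdd : ∀ z : ℂ, z.im ≠ 0 → ∃ K : NNReal, ∀ x ∈ M z, ‖x.2‖ ≤ K * ‖x.1‖ := fun z hz => by
      obtain ⟨σ, hσ, h⟩ := hM'.exists_isMaxSemi hz
      exact h.1.exists_norm_snd_le hσ h.isClosed (hclosed' z hz) (hsup z hz)
    refine ⟨⟨⟨hM, fun z hz => ?_⟩, fun z hz => ker_imPart_eq_bot (hinf z hz)⟩, fun z hz =>
      isBoundedOp_inv_imPart (hclosed z hz) (hclosed' z hz) (hsup z hz) (hinf z hz)⟩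
    obtain ⟨K, hK⟩ := hbdd z hz
    -- Since `M(z)* = M(conj z)`, the bound at the conjugate point is the bound for the adjoint.
    obtain ⟨K', hK'⟩ := hbdd (conj z) (by simpa using hz)
    rw [← hM'.adjoint_eq z hz] at hK'
    exact dom_eq_top_of_norm_snd_le (hclosed z hz) hK hK'
  · rintro ⟨⟨⟨hM, hdom⟩, -⟩, hb⟩
    refine ⟨hM, fun z hz => sup_adjoint_eq_top ?_ (hb z hz)⟩
    rw [IsNevanlinnaFamily.adjoint_eq hM z hz]
    exact hdom _ (by simpa using hz)

end Families

end Nevanlinna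

theorem theorem3p11 {H : Type*} [NormedAddCommGroup H] [InnerProductSpace ℂ H] [CompleteSpace H]
    (W : Nevanlinna.LinRel (Nevanlinna.Sq H) (Nevanlinna.Sq H))
    (hW : Nevanlinna.IsStandardUnitary (Nevanlinna.J H) (Nevanlinna.J H) W) :
    (∀ M ∈ Nevanlinna.Rtilde H, (fun z => Nevanlinna.shmulyan W (M z)) ∈ Nevanlinna.Rtilde H) ∧
    (∀ M ∈ Nevanlinna.Rconst H, (fun z => Nevanlinna.shmulyan W (M z)) ∈ Nevanlinna.Rconst H) ∧
    (∀ M ∈ Nevanlinna.Rstrict H, (fun z => Nevanlinna.shmulyan W (M z)) ∈ Nevanlinna.Rstrict H) ∧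
    Nevanlinna.Runif H = Nevanlinna.RunifBdd H ∧
    (∀ M ∈ Nevanlinna.Runif H, (fun z => Nevanlinna.shmulyan W (M z)) ∈ Nevanlinna.Runif H) := by
  obtain ⟨e, he, hWe⟩ := hW.exists_continuousLinearEquiv
  simp only [hWe]
  have hR : ∀ M ∈ Nevanlinna.Rtilde H,
      (fun z => (M z).map ((e : (H × H) →L[ℂ] (H × H)) : (H × H) →ₗ[ℂ] (H × H))) ∈
        Nevanlinna.Rtilde H := fun M hM => Nevanlinna.IsNevanlinnaFamily.map hM he
  refine ⟨hR, ?_, ?_, Nevanlinna.runif_eq_runifBdd, ?_⟩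
  · rintro M ⟨hM, Θ, hΘ⟩
    exact ⟨hR M hM, _, fun z hz => congrArg _ (hΘ z hz)⟩
  · rintro M ⟨hM, h⟩
    refine ⟨hR M hM, fun z hz => ?_⟩
    rw [Nevanlinna.adjoint_map_of_sympForm he]
    refine (Submodule.map_inf _ e.injective).symm.trans ?_
    rw [h z hz, Submodule.map_bot]
  · rintro M ⟨hM, h⟩
    refine ⟨hR M hM, fun z hz => ?_⟩
    rw [Nevanlinna.adjoint_map_of_sympForm he, ← Submodule.map_sup, h z hz, Submodule.map_top,
      LinearMap.range_eq_top]
    exact e.surjective
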